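/- Let $d,N\ge 0$ and $n\ge 1$ be integers, let $0=t_0<t_1<\dots<t_n=T$, and let $x_0\in\mathbb{R}^d$. Let $G:\mathbb{R}^d\times\mathbb{R}^N\to\mathbb{R}$, $(y,\theta)\mapsto G(y,\theta)$ (for instance a feedforward neural network with smooth activation functions and parameter vector $\theta$), be differentiable in $y$, with gradient $\partial_yG:\mathbb{R}^d\times\mathbb{R}^N\to\mathbb{R}^d$ continuously differentiable jointly in $(y,\theta)$. Write $\partial_y^2G(y,\theta)\in\mathbb{R}^{d\times d}$ and $\partial_\theta\partial_yG(y,\theta)\in\mathbb{R}^{d\times N}$ for the Jacobians of $\partial_yG$ with respect to $y$ and to $\theta$. Consider the forward problem $$\dot y(t)=-\partial_yG(y(t),\theta)\quad(0\le t\le T),\qquad y(0)=x_0, \tag{1}$$ and, with $y(\cdot\,;\theta)$ denoting its solution, the objective $$J(\theta)=\sum_{i=1}^nL_i\big(y(t_i;\theta)\big),$$ where $L_1,\dots,L_n:\mathbb{R}^d\to\mathbb{R}$ are local losses, for example $L_i(y)=\|y-x_i\|^2$ with given data $x_i\in\mathbb{R}^d$. Let $\theta\in\mathbb{R}^N$ and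 let $y:[0,T]\to\mathbb{R}^d$ be a solution of (1) for this $\theta$. Assume that $L_i$ is differentiable at $y(t_i)$ for $i=1,\dots,n$. Then: 1. For all parameters $\eta$ in a neighbourhood of $\theta$, problem (1) with $\eta$ in place of $\theta$ has exactly one solution on $[0,T]$; in particular $J$ is well defined near $\theta$. 2. There is a co-state trajectory $p:[0,T]\to\mathbb{R}^d$, that is, a function with $$\dot p(t)=\big(\partial_y^2G(y(t),\theta)\big)^\top p(t),\qquad t_{i-1}\le t<t_i,\quad i=n,\dots,1$$ (with the right derivative at $t=t_{i-1}$), $$p(T^-)=p(T)=\partial_yL_n(y(T)),\qquad p(t_i^-)=p(t_i^+)+\partial_yL_i(y(t_i)),\quad i=n-1,\dots,1,$$ where $p(t_i^\pm)$ denote the one-sided limits of $p$ at $t_i$, which exist. 3. $J$ is differentiable at $\theta$ and, for every co-state trajectory $p$ as in 2, the function $t\mapsto\big(\partial_\theta\partial_yG(y(t),\theta)\big)^\top p(t)$ is integrable on $[0,T]$ and $$\nabla J(\theta)=-\sum_{i=0}^{n-1}\int_{t_i}^{t_{i+1}}\big(\partial_\theta\partial_yG(y(t),\theta)\big)^\top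 p(t)\,dt=-\int_0^T\big(\partial_\theta\partial_yG(y(t),\theta)\big)^\top p(t)\,dt.$$ -/

import Mathlib

open scoped Topology

noncomputable section

namespace OptimalControlNet

/-- The gradient `∂_y G(y, θ) ∈ ℝ^d` of `G(·, θ)` at `y`. -/
def gradY {d N : ℕ} (G : EuclideanSpace ℝ (Fin d) → EuclideanSpace ℝ (Fin N) → ℝ)
    (y : EuclideanSpace ℝ (Fin d)) (θ : EuclideanSpace ℝ (Fin N)) : EuclideanSpace ℝ (Fin d) :=
  gradient (fun z => G z θ) y

/-- The Hessian `∂²_y G(y, θ)`, a `d × d` matrix seen as a linear map `ℝ^d → ℝ^d`. -/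
def hessY {d N : ℕ} (G : EuclideanSpace ℝ (Fin d) → EuclideanSpace ℝ (Fin N) → ℝ)
    (y : EuclideanSpace ℝ (Fin d)) (θ : EuclideanSpace ℝ (Fin N)) :
    EuclideanSpace ℝ (Fin d) →L[ℝ] EuclideanSpace ℝ (Fin d) :=
  fderiv ℝ (fun z => gradY G z θ) y

/-- The mixed derivative `∂_θ ∂_y G(y, θ)`, a `d × N` matrix seen as a linear map `ℝ^N → ℝ^d`. -/
def mixedDeriv {d N : ℕ} (G : EuclideanSpace ℝ (Fin d) → EuclideanSpace ℝ (Fin N) → ℝ)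
    (y : EuclideanSpace ℝ (Fin d)) (θ : EuclideanSpace ℝ (Fin N)) :
    EuclideanSpace ℝ (Fin N) →L[ℝ] EuclideanSpace ℝ (Fin d) :=
  fderiv ℝ (fun η => gradY G y η) θ

/-- `y` is a state trajectory on `[0, T]` for the parameter `θ`, starting from `x₀`:
`ẏ(t) = -∂_y G(y(t), θ)` and `y(0) = x₀` (one-sided derivatives at the two end points). -/
structure IsStateTrajectory {d N : ℕ}
    (G : EuclideanSpace ℝ (Fin d) → EuclideanSpace ℝ (Fin N) → ℝ)
    (x₀ : EuclideanSpace ℝ (Fin d)) (T : ℝ) (θ : EuclideanSpace ℝ (Fin N))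
    (y : ℝ → EuclideanSpace ℝ (Fin d)) : Prop where
  init : y 0 = x₀
  ode : ∀ s ∈ Set.Icc (0 : ℝ) T, HasDerivWithinAt y (-gradY G (y s) θ) (Set.Icc 0 T) s

open Classical in
/-- The solution `y(· ; θ)` of the forward problem on `[0, T]` (zero if there is none). -/
def stateOf {d N : ℕ} (G : EuclideanSpace ℝ (Fin d) → EuclideanSpace ℝ (Fin N) → ℝ)
    (x₀ : EuclideanSpace ℝ (Fin d)) (T : ℝ) (θ : EuclideanSpace ℝ (Fin N)) :
    ℝ → EuclideanSpace ℝ (Fin d) :=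
  if h : ∃ y, IsStateTrajectory G x₀ T θ y then h.choose else 0

/-- The objective `J(θ) = ∑_{i=1}^n L_i(y(t_i ; θ))`. -/
def objective {d N : ℕ} (G : EuclideanSpace ℝ (Fin d) → EuclideanSpace ℝ (Fin N) → ℝ)
    (x₀ : EuclideanSpace ℝ (Fin d)) (T : ℝ) (n : ℕ) (t : ℕ → ℝ)
    (L : ℕ → EuclideanSpace ℝ (Fin d) → ℝ) (θ : EuclideanSpace ℝ (Fin N)) : ℝ :=
  ∑ i ∈ Finset.Icc 1 n, L i (stateOf G x₀ T θ (t i))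

/-- `p` is a co-state trajectory along the state trajectory `y`: on each interval
`[t_i, t_{i+1})`, `0 ≤ i < n`, it solves the adjoint equation, it has terminal value
`p(T) = ∂_y L_n(y(T))`, attained as a left limit, and at the interior nodes the one-sided
limits exist and satisfy `p(t_i⁻) = p(t_i⁺) + ∂_y L_i(y(t_i))`. -/
structure IsCostate {d N : ℕ} (G : EuclideanSpace ℝ (Fin d) → EuclideanSpace ℝ (Fin N) → ℝ)
    (T : ℝ) (n : ℕ) (t : ℕ → ℝ) (L : ℕ → EuclideanSpace ℝ (Fin d) → ℝ)
    (θ : EuclideanSpace ℝ (Fin N)) (y p : ℝ → EuclideanSpace ℝ (Fin d)) : Prop where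
  ode : ∀ i < n, ∀ s ∈ Set.Ico (t i) (t (i + 1)),
    HasDerivWithinAt p (ContinuousLinearMap.adjoint (hessY G (y s) θ) (p s))
      (Set.Ico (t i) (t (i + 1))) s
  terminal : p T = gradient (L n) (y T)
  left_cont : Filter.Tendsto p (𝓝[<] T) (𝓝 (p T))
  jump : ∀ i, 1 ≤ i → i < n → ∃ pl pr : EuclideanSpace ℝ (Fin d),
    Filter.Tendsto p (𝓝[<] (t i)) (𝓝 pl) ∧ Filter.Tendsto p (𝓝[>] (t i)) (𝓝 pr) ∧
      pl = pr + gradient (L i) (y (t i))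

end OptimalControlNet

end

/-! Let `δ = z η - y` be the variation of the state. It solves the equation linearized along `y`,
forced by `-mixedDeriv G (y s) θ (η - θ)`, up to a defect that is `o(‖η - θ‖)` uniformly in time.
The adjoint equation is chosen so that the derivative of `⟪p, δ⟫` contains only forcing and defect
(`abs_inner_sub_inner_sub_integral_le`). Summed over the intervals, the boundary terms telescope:
`δ` vanishes at time `0`, and each jump of `p` releases the linearized loss at its node. Hence the
linearized objective is minus the integral of the forcing against `p`.

The flow need not be differentiated in the parameter. A Lipschitz bound at `θ`
(`exists_solution_of_parameter_near`, by Gronwall) and a first order expansion uniform along the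
trajectory (`exists_forall_norm_sub_sub_fderiv_le`) suffice. Existence on all of `[0, T]` comes from
cutting the field off and showing that the solution stays where the cutoff equals `1`. -/

namespace OptimalControlNet

open Set Metric
open scoped NNReal

/-! ### Existence, uniqueness and parameter dependence for ODEs -/

section ODE

variable {E F : Type*} [NormedAddCommGroup E] [NormedSpace ℝ E]
  [NormedAddCommGroup F] [NormedSpace ℝ F]

/-- A bounded vector field which is continuous in time and uniformly Lipschitz in space has a
solution on the whole time interval. -/
theorem exists_hasDerivWithinAt_of_bounded_lipschitz [CompleteSpace E] {v : ℝ → E → E} {a b : ℝ}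
    (hab : a ≤ b) {K C : ℝ≥0} (hlip : ∀ s ∈ Icc a b, LipschitzWith K (v s))
    (hcont : ∀ x, ContinuousOn (fun s => v s x) (Icc a b))
    (hbdd : ∀ s ∈ Icc a b, ∀ x, ‖v s x‖ ≤ C) (x₀ : E) :
    ∃ z : ℝ → E, z a = x₀ ∧ ∀ s ∈ Icc a b, HasDerivWithinAt z (v s (z s)) (Icc a b) s := by
  -- A field bounded by `C` moves a point by at most `C * (b - a)`, so a ball of that radius removes
  -- the usual restriction to short times.
  have h : IsPicardLindelof v (tmin := a) (tmax := b) ⟨a, left_mem_Icc.2 hab⟩ x₀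
      (C * (b - a).toNNReal) 0 C K :=
    { lipschitzOnWith := fun s hs => (hlip s hs).lipschitzOnWith
      continuousOn := fun x _ => hcont x
      norm_le := fun s hs x _ => hbdd s hs x
      mul_max_le := by
        have : max (b - a) (a - a) = b - a := by simp [hab]
        simp only [this, NNReal.coe_mul, NNReal.coe_zero, sub_zero]
        rw [Real.coe_toNNReal _ (sub_nonneg.2 hab)] }
  exact h.exists_eq_forall_mem_Icc_hasDerivWithinAt₀

/-- Right derivatives from derivatives within a closed interval. -/
theorem hasDerivWithinAt_Ici_of_Icc {z : ℝ → E} {z' : E} {a b s : ℝ} (hs : s ∈ Ico a b)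
    (h : HasDerivWithinAt z z' (Icc a b) s) : HasDerivWithinAt z z' (Ici s) s :=
  h.mono_of_mem_nhdsWithin (Icc_mem_nhdsGE_of_mem hs)

/-- Linear initial value problems are globally solvable. -/
theorem exists_hasDerivWithinAt_linear [FiniteDimensional ℝ E] {M : ℝ → E →L[ℝ] E} {a b : ℝ}
    (hab : a ≤ b) (hM : ContinuousOn M (Icc a b)) (x₀ : E) :
    ∃ z : ℝ → E, z a = x₀ ∧ ∀ s ∈ Icc a b, HasDerivWithinAt z (M s (z s)) (Icc a b) s := by
  obtain ⟨m, hm⟩ := isCompact_Icc.exists_bound_of_continuousOn hM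
  have hm0 : 0 ≤ m := (norm_nonneg _).trans (hm a (left_mem_Icc.2 hab))
  -- The a priori Gronwall bound for the linear equation; the `+ 1` only makes the cutoff radius
  -- positive.
  set R : ℝ := gronwallBound ‖x₀‖ m 0 (b - a) + 1 with hR
  have hR0 : 0 < R := by
    rw [hR, gronwallBound_ε0]; positivity
  let χ : ContDiffBump (0 : E) := ⟨R, R + 1, hR0, by linarith⟩
  have hsmooth : ContDiff ℝ 1 (fun x : E => χ x • x) := χ.contDiff.smul contDiff_id
  have hsupp : HasCompactSupport (fun x : E => χ x • x) := χ.hasCompactSupport.smul_right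
  obtain ⟨K, hK⟩ := hsmooth.lipschitzWith_of_hasCompactSupport hsupp (by norm_num)
  obtain ⟨C, hC⟩ := hsupp.exists_bound_of_continuous hsmooth.continuous
  have hC0 : 0 ≤ C := (norm_nonneg _).trans (hC 0)
  obtain ⟨z, hz0, hz⟩ := exists_hasDerivWithinAt_of_bounded_lipschitz
    (v := fun s x => M s (χ x • x)) hab (K := m.toNNReal * K) (C := (m * C).toNNReal)
    (fun s hs => by
      refine ((M s).lipschitz.comp hK).weaken ?_
      gcongr
      rw [← NNReal.coe_le_coe, Real.coe_toNNReal _ hm0]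
      exact hm s hs)
    (fun x => hM.clm_apply continuousOn_const)
    (fun s hs x => by
      rw [Real.coe_toNNReal _ (by positivity)]
      exact ((M s).le_opNorm _).trans (mul_le_mul (hm s hs) (hC x) (norm_nonneg _) hm0)) x₀
  refine ⟨z, hz0, fun s hs => ?_⟩
  -- As `0 ≤ χ ≤ 1`, the truncated field has the same linear growth, so the bound does not depend on
  -- the cutoff and there is no circularity with `R`.
  have hbound := norm_le_gronwallBound_of_norm_deriv_right_le (f := z) (δ := ‖x₀‖) (K := m)
    (ε := 0) (fun s hs => (hz s hs).continuousWithinAt)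
    (fun s hs => hasDerivWithinAt_Ici_of_Icc hs (hz s (Ico_subset_Icc_self hs))) (by rw [hz0])
    (fun s hs => by
      rw [add_zero]
      refine ((M s).le_opNorm _).trans ?_
      refine mul_le_mul (hm s (Ico_subset_Icc_self hs)) ?_ (norm_nonneg _) hm0
      rw [norm_smul, Real.norm_of_nonneg χ.nonneg]
      exact mul_le_of_le_one_left (norm_nonneg _) χ.le_one)
  have hmem : z s ∈ closedBall (0 : E) χ.rIn := by
    rw [mem_closedBall_zero_iff]
    refine (hbound s hs).trans ?_
    have := gronwallBound_mono (norm_nonneg x₀) le_rfl hm0 (sub_le_sub_right hs.2 a)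
    exact this.trans (by simp [χ, hR])
  simpa [χ.one_of_mem_closedBall hmem] using hz s hs

/-- Linear terminal value problems are globally solvable. -/
theorem exists_hasDerivWithinAt_linear_terminal [FiniteDimensional ℝ E] {M : ℝ → E →L[ℝ] E}
    {a b : ℝ} (hab : a ≤ b) (hM : ContinuousOn M (Icc a b)) (x₁ : E) :
    ∃ z : ℝ → E, z b = x₁ ∧ ∀ s ∈ Icc a b, HasDerivWithinAt z (M s (z s)) (Icc a b) s := by
  -- Time reversal turns the terminal value into an initial value and flips the sign of `M`.
  have hmaps : MapsTo (fun s => a + b - s) (Icc a b) (Icc a b) := fun s hs =>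
    ⟨by linarith [hs.2], by linarith [hs.1]⟩
  obtain ⟨z, hz0, hz⟩ := exists_hasDerivWithinAt_linear (M := fun s => -M (a + b - s)) hab
    ((hM.comp (by fun_prop) hmaps).neg) x₁
  refine ⟨fun s => z (a + b - s), by simpa using hz0, fun s hs => ?_⟩
  have h1 : HasDerivWithinAt (fun s : ℝ => a + b - s) (-1) (Icc a b) s := by
    simpa using ((hasDerivAt_id s).const_sub (a + b)).hasDerivWithinAt
  have h2 := (hz (a + b - s) (hmaps hs)).scomp s h1 hmaps
  simpa [Function.comp_def] using h2

/-- Solutions of an autonomous equation with `C¹` right-hand side are unique. -/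
theorem eqOn_of_contDiff [FiniteDimensional ℝ E] {v : E → E} (hv : ContDiff ℝ 1 v) {a b : ℝ}
    {z w : ℝ → E} (hz : ∀ s ∈ Icc a b, HasDerivWithinAt z (v (z s)) (Icc a b) s)
    (hw : ∀ s ∈ Icc a b, HasDerivWithinAt w (v (w s)) (Icc a b) s) (h : w a = z a) :
    EqOn w z (Icc a b) := by
  have hzc : ContinuousOn z (Icc a b) := fun s hs => (hz s hs).continuousWithinAt
  have hwc : ContinuousOn w (Icc a b) := fun s hs => (hw s hs).continuousWithinAt
  obtain ⟨A, hA⟩ := isCompact_Icc.exists_bound_of_continuousOn hzc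
  obtain ⟨B, hB⟩ := isCompact_Icc.exists_bound_of_continuousOn hwc
  obtain ⟨K, hK⟩ := hv.contDiffOn.exists_lipschitzOnWith one_ne_zero
    (convex_closedBall (0 : E) (max A B)) (isCompact_closedBall _ _)
  refine ODE_solution_unique_of_mem_Icc_right (v := fun _ => v)
    (s := fun _ => closedBall (0 : E) (max A B)) (fun _ _ => hK) hwc
    (fun s hs => hasDerivWithinAt_Ici_of_Icc hs (hw s (Ico_subset_Icc_self hs)))
    (fun s hs => ?_) hzc
    (fun s hs => hasDerivWithinAt_Ici_of_Icc hs (hz s (Ico_subset_Icc_self hs)))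
    (fun s hs => ?_) h
  · exact mem_closedBall_zero_iff.2 ((hB s (Ico_subset_Icc_self hs)).trans (le_max_right _ _))
  · exact mem_closedBall_zero_iff.2 ((hA s (Ico_subset_Icc_self hs)).trans (le_max_left _ _))

/-- Solvability of a parameter dependent equation is stable under perturbation of the parameter,
and the solution is Lipschitz continuous in the parameter at the reference value. -/
theorem exists_solution_of_parameter_near [FiniteDimensional ℝ E] [FiniteDimensional ℝ F]
    {f : E × F → E} (hf : ContDiff ℝ 1 f) {T : ℝ} (hT : 0 ≤ T) {θ : F} {y : ℝ → E}
    (hy : ∀ s ∈ Icc 0 T, HasDerivWithinAt y (f (y s, θ)) (Icc 0 T) s) :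
    ∃ C : ℝ, 0 ≤ C ∧ ∀ᶠ η in 𝓝 θ, ∃ z : ℝ → E, z 0 = y 0 ∧
      (∀ s ∈ Icc 0 T, HasDerivWithinAt z (f (z s, η)) (Icc 0 T) s) ∧
      ∀ s ∈ Icc 0 T, ‖z s - y s‖ ≤ C * ‖η - θ‖ := by
  have hyc : ContinuousOn y (Icc 0 T) := fun s hs => (hy s hs).continuousWithinAt
  obtain ⟨A, hA⟩ := isCompact_Icc.exists_bound_of_continuousOn hyc
  have hA0 : 0 ≤ A := (norm_nonneg _).trans (hA 0 (left_mem_Icc.2 hT))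
  -- The cutoff is `1` on a unit margin around both the reference trajectory and the parameter `θ`;
  -- the product norm is a maximum.
  set R : ℝ := max (A + 1) (‖θ‖ + 1) with hR
  have hR0 : 0 < R := lt_max_of_lt_left (by linarith)
  let χ : ContDiffBump (0 : E × F) := ⟨R, R + 1, hR0, by linarith⟩
  have hχ : ∀ (x : E) (η : F), ‖x‖ ≤ A + 1 → ‖η‖ ≤ ‖θ‖ + 1 → χ (x, η) = 1 := fun x η hx hη =>
    χ.one_of_mem_closedBall (mem_closedBall_zero_iff.2
      (norm_prod_le_iff.2 ⟨hx.trans (le_max_left _ _), hη.trans (le_max_right _ _)⟩))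
  have hsmooth : ContDiff ℝ 1 (fun q : E × F => χ q • f q) := χ.contDiff.smul hf
  have hsupp : HasCompactSupport (fun q : E × F => χ q • f q) := χ.hasCompactSupport.smul_right
  obtain ⟨K, hK⟩ := hsmooth.lipschitzWith_of_hasCompactSupport hsupp (by norm_num)
  obtain ⟨B, hB⟩ := hsupp.exists_bound_of_continuous hsmooth.continuous
  have hB0 : 0 ≤ B := (norm_nonneg _).trans (hB 0)
  have hKx : ∀ η : F, LipschitzWith K (fun x : E => χ (x, η) • f (x, η)) := fun η => by
    simpa [Function.comp_def] using hK.comp (LipschitzWith.prodMk_right η)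
  -- `c` is `exp (K * T) - 1`; `hgr` records that the Gronwall bound is linear in the defect.
  obtain ⟨c, hc⟩ : ∃ c : ℝ, c = gronwallBound 0 K K T := ⟨_, rfl⟩
  have hgr : ∀ ε : ℝ, gronwallBound 0 K (K * ε) T = c * ε := fun ε => by
    rw [hc]
    rcases eq_or_ne (K : ℝ) 0 with h | h
    · simp [h, gronwallBound_K0]
    · rw [gronwallBound_of_K_ne_0 h, gronwallBound_of_K_ne_0 h]; ring
  have hc0 : 0 ≤ c := by
    have := gronwallBound_mono (K := (K : ℝ)) (ε := K) le_rfl K.2 K.2 hT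
    rwa [gronwallBound_x0, ← hc] at this
  refine ⟨c, hc0, ?_⟩
  -- The first bound keeps `η` in its unit margin, the second keeps the solution within distance `1`
  -- of `y`.
  have hnear : ∀ᶠ η in 𝓝 θ, ‖η - θ‖ < min 1 (1 / (c + 1)) := by
    have : ContinuousAt (fun η : F => ‖η - θ‖) θ := by fun_prop
    exact this.eventually_lt continuousAt_const (by simp; positivity)
  filter_upwards [hnear] with η hη
  have hη1 : ‖η - θ‖ ≤ 1 := (hη.trans_le (min_le_left _ _)).le
  have hηn : ‖η‖ ≤ ‖θ‖ + 1 := by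
    have := norm_add_le θ (η - θ)
    rw [add_sub_cancel] at this
    linarith
  have hηc : c * ‖η - θ‖ ≤ 1 := by
    have h := (hη.trans_le (min_le_right _ _)).le
    rw [le_div_iff₀ (by positivity)] at h
    nlinarith [norm_nonneg (η - θ)]
  obtain ⟨z, hz0, hz⟩ := exists_hasDerivWithinAt_of_bounded_lipschitz
    (v := fun _ x => χ (x, η) • f (x, η)) hT (K := K) (C := B.toNNReal)
    (fun s _ => hKx η) (fun x => continuousOn_const)
    (fun s _ x => by rw [Real.coe_toNNReal _ hB0]; exact hB _) (y 0)
  have hzc : ContinuousOn z (Icc 0 T) := fun s hs => (hz s hs).continuousWithinAt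
  have hclose : ∀ s ∈ Icc 0 T, ‖z s - y s‖ ≤ c * ‖η - θ‖ := fun s hs => by
    -- `y` is treated as an approximate solution of the truncated equation for `η`, with defect at
    -- most `K * ‖η - θ‖`.
    have := dist_le_of_approx_trajectories_ODE (v := fun _ x => χ (x, η) • f (x, η)) (K := K)
      (εf := 0) (εg := K * ‖η - θ‖) (δ := 0) (fun _ => hKx η) hzc
      (fun s hs => hasDerivWithinAt_Ici_of_Icc hs (hz s (Ico_subset_Icc_self hs)))
      (fun s _ => by simp) hyc
      (fun s hs => hasDerivWithinAt_Ici_of_Icc hs (hy s (Ico_subset_Icc_self hs)))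
      (fun s hs => by
        have h1 : f (y s, θ) = χ (y s, θ) • f (y s, θ) := by
          rw [hχ _ _ ((hA s (Ico_subset_Icc_self hs)).trans (by linarith)) (by linarith), one_smul]
        rw [h1]
        have h2 := hK.dist_le_mul (y s, θ) (y s, η)
        rwa [Prod.dist_eq, dist_self, max_eq_right dist_nonneg, dist_comm θ, dist_eq_norm η] at h2)
      (by simp [hz0]) s hs
    rw [dist_eq_norm, sub_zero, zero_add] at this
    refine this.trans ((gronwallBound_mono le_rfl (by positivity) K.2 hs.2).trans (hgr _).le)
  refine ⟨z, hz0, fun s hs => ?_, hclose⟩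
  have hzn : ‖z s‖ ≤ A + 1 := by
    have := norm_add_le (y s) (z s - y s)
    rw [add_sub_cancel] at this
    linarith [hA s hs, hclose s hs]
  simpa [hχ _ _ hzn hηn] using hz s hs

/-- First order expansion of a `C¹` map, uniformly along a compact set. -/
theorem exists_forall_norm_sub_sub_fderiv_le {f : E → F} (hf : ContDiff ℝ 1 f) {S : Set E}
    (hS : IsCompact S) {ε : ℝ} (hε : 0 < ε) :
    ∃ δ > 0, ∀ x ∈ S, ∀ x', ‖x' - x‖ < δ →
      ‖f x' - f x - fderiv ℝ f x (x' - x)‖ ≤ ε * ‖x' - x‖ := by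
  have h := hS.uniformContinuousAt_of_continuousAt (fderiv ℝ f)
    (fun x _ => (hf.continuous_fderiv one_ne_zero).continuousAt) (dist_mem_uniformity hε)
  obtain ⟨δ, hδ, H⟩ := mem_uniformity_dist.1 h
  refine ⟨δ, hδ, fun x hx x' hx' => ?_⟩
  refine (convex_ball x δ).norm_image_sub_le_of_norm_fderiv_le' (𝕜 := ℝ)
    (fun u _ => hf.differentiable one_ne_zero u) (fun u hu => ?_) (mem_ball_self hδ)
    (by rwa [mem_ball, dist_eq_norm])
  have := H (a := x) (b := u) (by rwa [dist_comm]) hx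
  rw [← dist_eq_norm, dist_comm]
  exact le_of_lt this

end ODE

end OptimalControlNet

/-! ### Nodes, co-state trajectories and duality -/

namespace OptimalControlNet

open Set Metric
open scoped InnerProductSpace

/-- Backward recursion. -/
theorem exists_backward_recursion {α : Type*} (n : ℕ) (S : ℕ → α → α) (x : α) :
    ∃ q : ℕ → α, q n = x ∧ ∀ i < n, q i = S i (q (i + 1)) := by
  let r : ℕ → α := fun k => Nat.rec x (fun k u => S (n - (k + 1)) u) k
  refine ⟨fun i => r (n - i), by simp [r], fun i hi => ?_⟩
  have h : n - i = (n - (i + 1)) + 1 := by omega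
  have h' : n - (n - (i + 1) + 1) = i := by omega
  change r (n - i) = S i (r (n - (i + 1)))
  rw [h]
  change S (n - (n - (i + 1) + 1)) _ = _
  rw [h']

theorem node_le {n : ℕ} {t : ℕ → ℝ} (ht : ∀ i < n, t i < t (i + 1)) {i j : ℕ} (hij : i ≤ j)
    (hj : j ≤ n) : t i ≤ t j := by
  induction j, hij using Nat.le_induction with
  | base => exact le_rfl
  | succ j _ ih => exact (ih (by omega)).trans (ht j (by omega)).le

theorem Icc_node_subset {n : ℕ} {t : ℕ → ℝ} (ht : ∀ i < n, t i < t (i + 1)) {i : ℕ} (hi : i < n) :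
    Icc (t i) (t (i + 1)) ⊆ Icc (t 0) (t n) :=
  Icc_subset_Icc (node_le ht (Nat.zero_le i) hi.le) (node_le ht hi le_rfl)

/-- Counting the nodes already passed recovers the index of the interval containing `s`, so that
pieces can be glued by an explicit formula. -/
theorem card_nodes_le {n : ℕ} {t : ℕ → ℝ} (ht : ∀ i < n, t i < t (i + 1)) {i : ℕ} (hi : i < n)
    {s : ℝ} (hs : s ∈ Ico (t i) (t (i + 1))) :
    ((Finset.range n).filter (fun j => t (j + 1) ≤ s)).card = i := by
  have : (Finset.range n).filter (fun j => t (j + 1) ≤ s) = Finset.range i := by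
    ext j
    simp only [Finset.mem_filter, Finset.mem_range]
    constructor
    · rintro ⟨hj, hjs⟩
      by_contra! h
      have := node_le ht (Nat.succ_le_succ h) hj
      exact absurd (this.trans hjs) (not_le.2 hs.2)
    · intro hj
      exact ⟨hj.trans hi, (node_le ht hj hi.le).trans hs.1⟩
  rw [this, Finset.card_range]

section Setting

variable {d N : ℕ} {G : EuclideanSpace ℝ (Fin d) → EuclideanSpace ℝ (Fin N) → ℝ}

/-- Links the partial derivative to the joint one, from which both its continuity along `y` and the
joint first order expansion are obtained. -/
theorem hessY_eq_fderiv_comp_inl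
    (hG' : ContDiff ℝ 1 (fun q : EuclideanSpace ℝ (Fin d) × EuclideanSpace ℝ (Fin N) =>
      gradY G q.1 q.2)) (y : EuclideanSpace ℝ (Fin d)) (θ : EuclideanSpace ℝ (Fin N)) :
    hessY G y θ = (fderiv ℝ (fun q : EuclideanSpace ℝ (Fin d) × EuclideanSpace ℝ (Fin N) =>
      gradY G q.1 q.2) (y, θ)).comp (ContinuousLinearMap.inl ℝ _ _) :=
  HasFDerivAt.fderiv (((hG'.differentiable one_ne_zero (y, θ)).hasFDerivAt).comp
    (f := fun z => (z, θ)) y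
      (hasFDerivAt_prodMk_left y θ))

theorem mixedDeriv_eq_fderiv_comp_inr
    (hG' : ContDiff ℝ 1 (fun q : EuclideanSpace ℝ (Fin d) × EuclideanSpace ℝ (Fin N) =>
      gradY G q.1 q.2)) (y : EuclideanSpace ℝ (Fin d)) (θ : EuclideanSpace ℝ (Fin N)) :
    mixedDeriv G y θ = (fderiv ℝ (fun q : EuclideanSpace ℝ (Fin d) × EuclideanSpace ℝ (Fin N) =>
      gradY G q.1 q.2) (y, θ)).comp (ContinuousLinearMap.inr ℝ _ _) :=
  HasFDerivAt.fderiv (((hG'.differentiable one_ne_zero (y, θ)).hasFDerivAt).comp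
    (f := fun η => (y, η)) θ
      (hasFDerivAt_prodMk_right y θ))

theorem continuousOn_hessY
    (hG' : ContDiff ℝ 1 (fun q : EuclideanSpace ℝ (Fin d) × EuclideanSpace ℝ (Fin N) =>
      gradY G q.1 q.2)) {θ : EuclideanSpace ℝ (Fin N)} {y : ℝ → EuclideanSpace ℝ (Fin d)}
    {S : Set ℝ} (hy : ContinuousOn y S) : ContinuousOn (fun s => hessY G (y s) θ) S := by
  simp only [hessY_eq_fderiv_comp_inl hG']
  exact ((hG'.continuous_fderiv one_ne_zero).comp_continuousOn
    (hy.prodMk continuousOn_const)).clm_comp continuousOn_const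

theorem continuousOn_mixedDeriv
    (hG' : ContDiff ℝ 1 (fun q : EuclideanSpace ℝ (Fin d) × EuclideanSpace ℝ (Fin N) =>
      gradY G q.1 q.2)) {θ : EuclideanSpace ℝ (Fin N)} {y : ℝ → EuclideanSpace ℝ (Fin d)}
    {S : Set ℝ} (hy : ContinuousOn y S) : ContinuousOn (fun s => mixedDeriv G (y s) θ) S := by
  simp only [mixedDeriv_eq_fderiv_comp_inr hG']
  exact ((hG'.continuous_fderiv one_ne_zero).comp_continuousOn
    (hy.prodMk continuousOn_const)).clm_comp continuousOn_const

theorem IsStateTrajectory.continuousOn {x₀ : EuclideanSpace ℝ (Fin d)} {T : ℝ}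
    {θ : EuclideanSpace ℝ (Fin N)} {y : ℝ → EuclideanSpace ℝ (Fin d)}
    (hy : IsStateTrajectory G x₀ T θ y) : ContinuousOn y (Icc 0 T) :=
  fun s hs => (hy.ode s hs).continuousWithinAt

/-- The adjoint equation is linear, hence solvable backwards on each closed interval; each terminal
value is the next piece's initial value plus the loss gradient. -/
theorem exists_isCostate
    (hG' : ContDiff ℝ 1 (fun q : EuclideanSpace ℝ (Fin d) × EuclideanSpace ℝ (Fin N) =>
      gradY G q.1 q.2)) {T : ℝ} {n : ℕ} (hn : 1 ≤ n) {t : ℕ → ℝ} (ht0 : t 0 = 0) (htn : t n = T)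
    (ht : ∀ i < n, t i < t (i + 1)) (L : ℕ → EuclideanSpace ℝ (Fin d) → ℝ)
    {θ : EuclideanSpace ℝ (Fin N)} {y : ℝ → EuclideanSpace ℝ (Fin d)}
    (hy : ContinuousOn y (Icc 0 T)) : ∃ p, IsCostate G T n t L θ y p := by
  have hM : ContinuousOn (fun s => ContinuousLinearMap.adjoint (hessY G (y s) θ)) (Icc 0 T) :=
    ContinuousLinearMap.adjoint.continuous.comp_continuousOn (continuousOn_hessY hG' hy)
  have hex : ∀ (i : ℕ) (v : EuclideanSpace ℝ (Fin d)), ∃ q : ℝ → EuclideanSpace ℝ (Fin d), i < n →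
      q (t (i + 1)) = v ∧ ∀ s ∈ Icc (t i) (t (i + 1)), HasDerivWithinAt q
        (ContinuousLinearMap.adjoint (hessY G (y s) θ) (q s)) (Icc (t i) (t (i + 1))) s := by
    intro i v
    by_cases hi : i < n
    · obtain ⟨q, hq⟩ := exists_hasDerivWithinAt_linear_terminal (ht i hi).le
        (hM.mono (by simpa only [ht0, htn] using Icc_node_subset ht hi)) v
      exact ⟨q, fun _ => hq⟩
    · exact ⟨0, fun h => absurd h hi⟩
  choose S hS using hex
  -- Starting from a fictitious piece `q n = 0` beyond `T` makes the terminal condition one more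
  -- jump condition.
  obtain ⟨q, hqn, hq⟩ := exists_backward_recursion n
    (fun i u => S i (u (t (i + 1)) + gradient (L (i + 1)) (y (t (i + 1))))) 0
  have hqterm : ∀ i < n, q i (t (i + 1)) =
      q (i + 1) (t (i + 1)) + gradient (L (i + 1)) (y (t (i + 1))) := fun i hi => by
    rw [hq i hi]; exact (hS _ _ hi).1
  have hqode : ∀ i < n, ∀ s ∈ Icc (t i) (t (i + 1)), HasDerivWithinAt (q i)
      (ContinuousLinearMap.adjoint (hessY G (y s) θ) (q i s)) (Icc (t i) (t (i + 1))) s :=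
    fun i hi => by rw [hq i hi]; exact (hS _ _ hi).2
  -- `T` is treated apart: the count there is `n`, which would select the zero piece.
  let p : ℝ → EuclideanSpace ℝ (Fin d) := fun s => if s = T then gradient (L n) (y T) else
    q ((Finset.range n).filter (fun j => t (j + 1) ≤ s)).card s
  have hpT : p T = gradient (L n) (y T) := if_pos rfl
  have hpq : ∀ i < n, EqOn p (q i) (Ico (t i) (t (i + 1))) := fun i hi s hs => by
    have hsT : s ≠ T := by
      rw [← htn]; exact (hs.2.trans_le (node_le ht hi le_rfl)).ne
    simp only [p, if_neg hsT, card_nodes_le ht hi hs]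
  have hleft : ∀ i < n, Filter.Tendsto p (𝓝[<] (t (i + 1))) (𝓝 (q i (t (i + 1)))) := fun i hi => by
    have h1 := (hqode i hi _ (right_mem_Icc.2 (ht i hi).le)).continuousWithinAt.tendsto
    have h2 := h1.mono_left (nhdsWithin_mono _ (Ico_subset_Icc_self))
    rw [nhdsWithin_Ico_eq_nhdsLT (ht i hi)] at h2
    refine h2.congr' ?_
    filter_upwards [Ico_mem_nhdsLT (ht i hi)] with s hs using (hpq i hi hs).symm
  have hright : ∀ i < n, Filter.Tendsto p (𝓝[>] (t i)) (𝓝 (q i (t i))) := fun i hi => by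
    have h1 := (hqode i hi _ (left_mem_Icc.2 (ht i hi).le)).continuousWithinAt.tendsto
    have h2 := h1.mono_left (nhdsWithin_mono _ (Ioc_subset_Icc_self))
    rw [nhdsWithin_Ioc_eq_nhdsGT (ht i hi)] at h2
    refine h2.congr' ?_
    filter_upwards [Ioo_mem_nhdsGT (ht i hi)] with s hs using (hpq i hi ⟨hs.1.le, hs.2⟩).symm
  refine ⟨p, fun i hi s hs => ?_, hpT, ?_, fun i hi1 hin => ?_⟩
  · rw [hpq i hi hs]
    exact ((hqode i hi s (Ico_subset_Icc_self hs)).mono Ico_subset_Icc_self).congr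
      (hpq i hi) (hpq i hi hs)
  · obtain ⟨m, rfl⟩ : ∃ m, n = m + 1 := ⟨n - 1, by omega⟩
    have h := hleft m (by omega)
    rw [hqterm m (by omega), hqn, htn] at h
    simpa [hpT] using h
  · obtain ⟨m, rfl⟩ : ∃ m, i = m + 1 := ⟨i - 1, by omega⟩
    exact ⟨_, _, hleft m (by omega), hright (m + 1) hin, hqterm m (by omega)⟩

/-- On each closed interval between two nodes a co-state trajectory has a continuous version. -/
theorem IsCostate.exists_continuous_extension {T : ℝ} {n : ℕ} {t : ℕ → ℝ} (htn : t n = T)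
    (ht : ∀ i < n, t i < t (i + 1)) {L : ℕ → EuclideanSpace ℝ (Fin d) → ℝ}
    {θ : EuclideanSpace ℝ (Fin N)} {y p : ℝ → EuclideanSpace ℝ (Fin d)}
    (hp : IsCostate G T n t L θ y p) :
    ∃ P : ℕ → ℝ → EuclideanSpace ℝ (Fin d),
      (∀ i < n, ContinuousOn (P i) (Icc (t i) (t (i + 1)))) ∧
      (∀ i < n, EqOn p (P i) (Ico (t i) (t (i + 1)))) ∧
      (∀ i < n, ∀ s ∈ Ioo (t i) (t (i + 1)), HasDerivAt (P i)
        (ContinuousLinearMap.adjoint (hessY G (y s) θ) (P i s)) s) ∧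
      P n = 0 ∧
      ∀ i < n, P i (t (i + 1)) =
        P (i + 1) (t (i + 1)) + gradient (L (i + 1)) (y (t (i + 1))) := by
  -- The left limits at the nodes. At interior nodes the right limit equals the value of `p`, since
  -- the adjoint equation includes left end points; at `T` the value beyond is replaced by `0`.
  have hl : ∀ i, ∃ l, i < n → Filter.Tendsto p (𝓝[<] (t (i + 1))) (𝓝 l) ∧
      l = (if i + 1 < n then p (t (i + 1)) else 0) + gradient (L (i + 1)) (y (t (i + 1))) := by
    intro i
    by_cases hi : i + 1 < n
    · obtain ⟨pl, pr, h1, h2, h3⟩ := hp.jump (i + 1) (by omega) hi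
      refine ⟨pl, fun _ => ⟨h1, ?_⟩⟩
      rw [h3, if_pos hi]
      have h4 := (hp.ode (i + 1) hi _ (left_mem_Ico.2 (ht _ hi))).continuousWithinAt.tendsto
      have h5 := h4.mono_left (nhdsWithin_mono _ Ioo_subset_Ico_self)
      rw [nhdsWithin_Ioo_eq_nhdsGT (ht _ hi)] at h5
      rw [tendsto_nhds_unique h2 h5]
    · refine ⟨p T, fun hi' => ?_⟩
      obtain rfl : n = i + 1 := by omega
      rw [htn, if_neg hi, zero_add]
      exact ⟨hp.left_cont, hp.terminal⟩
  choose l hl using hl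
  -- Only the value at the right end point is changed, to the left limit there.
  refine ⟨fun i => if i < n then Function.update p (t (i + 1)) (l i) else 0,
    fun i hi => ?_, fun i hi s hs => ?_, fun i hi s hs => ?_, by simp, fun i hi => ?_⟩
  · simp only [if_pos hi]
    rw [continuousOn_update_iff]
    constructor
    · rw [Icc_sdiff_right]
      exact fun s hs => (hp.ode i hi s hs).continuousWithinAt
    · intro _
      rw [Icc_sdiff_right, nhdsWithin_Ico_eq_nhdsLT (ht i hi)]
      exact (hl i hi).1
  · simp only [if_pos hi, Function.update_of_ne hs.2.ne]
  · simp only [if_pos hi, Function.update_of_ne hs.2.ne]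
    refine ((hp.ode i hi s (Ioo_subset_Ico_self hs)).hasDerivAt
      (Ico_mem_nhds hs.1 hs.2)).congr_of_eventuallyEq ?_
    filter_upwards [isOpen_ne.mem_nhds hs.2.ne] with u hu using Function.update_of_ne hu _ _
  · simp only [if_pos hi, Function.update_self]
    rw [(hl i hi).2]
    split_ifs with h
    · rw [Function.update_of_ne (ht _ h).ne]
    · simp

end Setting

/-- Integrated form of the duality between a linear equation with a defect of size `ε` and its
adjoint equation. -/
theorem abs_inner_sub_inner_sub_integral_le {E : Type*} [NormedAddCommGroup E]
    [InnerProductSpace ℝ E] [CompleteSpace E] {a b : ℝ} (hab : a ≤ b) {A : ℝ → E →L[ℝ] E}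
    {p δ δ' g : ℝ → E} (hA : ContinuousOn A (Icc a b)) (hp : ContinuousOn p (Icc a b))
    (hp' : ∀ s ∈ Ioo a b, HasDerivAt p (-ContinuousLinearMap.adjoint (A s) (p s)) s)
    (hδ : ∀ s ∈ Icc a b, HasDerivWithinAt δ (δ' s) (Icc a b) s)
    (hδ' : ContinuousOn δ' (Icc a b)) (hg : ContinuousOn g (Icc a b)) {m ε : ℝ}
    (hm : ∀ s ∈ Icc a b, ‖p s‖ ≤ m) (hε : ∀ s ∈ Icc a b, ‖δ' s - A s (δ s) - g s‖ ≤ ε) :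
    |⟪p b, δ b⟫_ℝ - ⟪p a, δ a⟫_ℝ - ∫ s in a..b, ⟪p s, g s⟫_ℝ| ≤ m * ε * (b - a) := by
  have hδc : ContinuousOn δ (Icc a b) := fun s hs => (hδ s hs).continuousWithinAt
  have hm0 : 0 ≤ m := (norm_nonneg _).trans (hm a (left_mem_Icc.2 hab))
  have hint1 : IntervalIntegrable (fun s => ⟪p s, δ' s - A s (δ s)⟫_ℝ) MeasureTheory.volume a b :=
    (hp.inner (𝕜 := ℝ) (hδ'.sub (hA.clm_apply hδc))).intervalIntegrable_of_Icc hab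
  have hint2 : IntervalIntegrable (fun s => ⟪p s, g s⟫_ℝ) MeasureTheory.volume a b :=
    (hp.inner (𝕜 := ℝ) hg).intervalIntegrable_of_Icc hab
  -- In the product rule, the adjoint term cancels the homogeneous part of `δ'`.
  have hftc := intervalIntegral.integral_eq_sub_of_hasDerivAt_of_le
    (f := fun s => ⟪p s, δ s⟫_ℝ) (f' := fun s => ⟪p s, δ' s - A s (δ s)⟫_ℝ) hab
    (hp.inner (𝕜 := ℝ) hδc) (fun s hs => by
      have h := (hp' s hs).inner ℝ ((hδ s (Ioo_subset_Icc_self hs)).hasDerivAt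
        (Icc_mem_nhds hs.1 hs.2))
      rwa [inner_neg_left, ContinuousLinearMap.adjoint_inner_left, ← sub_eq_add_neg,
        ← inner_sub_right] at h) hint1
  rw [← hftc, ← intervalIntegral.integral_sub hint1 hint2, ← Real.norm_eq_abs]
  have := intervalIntegral.norm_integral_le_of_norm_le_const (a := a) (b := b)
    (f := fun s => ⟪p s, δ' s - A s (δ s)⟫_ℝ - ⟪p s, g s⟫_ℝ) (C := m * ε) (fun s hs => by
      rw [uIoc_of_le hab] at hs
      have hs' := Ioc_subset_Icc_self hs
      rw [← inner_sub_right]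
      exact (norm_inner_le_norm _ _).trans
        (mul_le_mul (hm s hs') (hε s hs') (norm_nonneg _) hm0))
  rwa [abs_of_nonneg (sub_nonneg.2 hab)] at this

end OptimalControlNet

/-! ### First order expansion of the objective -/

namespace OptimalControlNet

open Set Metric
open scoped InnerProductSpace

variable {d N : ℕ} {G : EuclideanSpace ℝ (Fin d) → EuclideanSpace ℝ (Fin N) → ℝ}

theorem IsStateTrajectory.eqOn
    (hG' : ContDiff ℝ 1 (fun q : EuclideanSpace ℝ (Fin d) × EuclideanSpace ℝ (Fin N) =>
      gradY G q.1 q.2)) {x₀ : EuclideanSpace ℝ (Fin d)} {T : ℝ} {θ : EuclideanSpace ℝ (Fin N)}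
    {z w : ℝ → EuclideanSpace ℝ (Fin d)} (hz : IsStateTrajectory G x₀ T θ z)
    (hw : IsStateTrajectory G x₀ T θ w) : EqOn w z (Icc 0 T) :=
  eqOn_of_contDiff (v := fun x => -gradY G x θ)
    (hG'.comp (contDiff_id.prodMk contDiff_const)).neg hz.ode hw.ode (hw.init.trans hz.init.symm)

theorem IsStateTrajectory.stateOf {x₀ : EuclideanSpace ℝ (Fin d)} {T : ℝ}
    {θ : EuclideanSpace ℝ (Fin N)} {z : ℝ → EuclideanSpace ℝ (Fin d)}
    (hz : IsStateTrajectory G x₀ T θ z) :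
    IsStateTrajectory G x₀ T θ (stateOf G x₀ T θ) := by
  have h : ∃ z, IsStateTrajectory G x₀ T θ z := ⟨z, hz⟩
  rw [OptimalControlNet.stateOf, dif_pos h]
  exact h.choose_spec

/-- The forward problem stays solvable near `θ`, with solutions depending on the parameter in a
Lipschitz way at `θ`. -/
theorem IsStateTrajectory.exists_near
    (hG' : ContDiff ℝ 1 (fun q : EuclideanSpace ℝ (Fin d) × EuclideanSpace ℝ (Fin N) =>
      gradY G q.1 q.2)) {x₀ : EuclideanSpace ℝ (Fin d)} {T : ℝ} (hT : 0 ≤ T)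
    {θ : EuclideanSpace ℝ (Fin N)} {y : ℝ → EuclideanSpace ℝ (Fin d)}
    (hy : IsStateTrajectory G x₀ T θ y) :
    ∃ C : ℝ, 0 ≤ C ∧ ∀ᶠ η in 𝓝 θ, ∃ z, IsStateTrajectory G x₀ T η z ∧
      ∀ s ∈ Icc 0 T, ‖z s - y s‖ ≤ C * ‖η - θ‖ := by
  obtain ⟨C, hC, h⟩ := exists_solution_of_parameter_near (f := fun q => -gradY G q.1 q.2)
    hG'.neg hT hy.ode
  refine ⟨C, hC, h.mono ?_⟩
  rintro η ⟨z, hz0, hz, hzy⟩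
  exact ⟨z, ⟨hz0.trans hy.init, hz⟩, hzy⟩

/-- The linearized objective is represented by the co-state, up to a remainder of higher order. -/
theorem isLittleO_linearized_objective_add_integral
    (hG' : ContDiff ℝ 1 (fun q : EuclideanSpace ℝ (Fin d) × EuclideanSpace ℝ (Fin N) =>
      gradY G q.1 q.2)) {x₀ : EuclideanSpace ℝ (Fin d)} {T : ℝ} {n : ℕ} {t : ℕ → ℝ}
    (ht0 : t 0 = 0) (htn : t n = T) (ht : ∀ i < n, t i < t (i + 1))
    {θ : EuclideanSpace ℝ (Fin N)} {y : ℝ → EuclideanSpace ℝ (Fin d)}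
    (hy : IsStateTrajectory G x₀ T θ y)
    {z : EuclideanSpace ℝ (Fin N) → ℝ → EuclideanSpace ℝ (Fin d)} {C : ℝ} (hC : 0 ≤ C)
    (hz : ∀ᶠ η in 𝓝 θ, IsStateTrajectory G x₀ T η (z η) ∧
      ∀ s ∈ Icc 0 T, ‖z η s - y s‖ ≤ C * ‖η - θ‖)
    {P : ℕ → ℝ → EuclideanSpace ℝ (Fin d)} {v : ℕ → EuclideanSpace ℝ (Fin d)}
    (hPc : ∀ i < n, ContinuousOn (P i) (Icc (t i) (t (i + 1))))
    (hPd : ∀ i < n, ∀ s ∈ Ioo (t i) (t (i + 1)), HasDerivAt (P i)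
        (ContinuousLinearMap.adjoint (hessY G (y s) θ) (P i s)) s)
    (hPn : P n = 0) (hPj : ∀ i < n, P i (t (i + 1)) = P (i + 1) (t (i + 1)) + v i) :
    (fun η => ∑ i ∈ Finset.range n, ⟪v i, z η (t (i + 1)) - y (t (i + 1))⟫_ℝ +
      ∑ i ∈ Finset.range n, ∫ s in (t i)..(t (i + 1)),
        ⟪P i s, mixedDeriv G (y s) θ (η - θ)⟫_ℝ) =o[𝓝 θ] (fun η => η - θ) := by
  have hT : 0 ≤ T := by rw [← ht0, ← htn]; exact node_le ht (Nat.zero_le n) le_rfl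
  have hsub : ∀ i < n, Icc (t i) (t (i + 1)) ⊆ Icc 0 T := fun i hi => by
    simpa only [ht0, htn] using Icc_node_subset ht hi
  obtain ⟨m, hm⟩ : ∃ m : ℝ, ∀ i < n, ∀ s ∈ Icc (t i) (t (i + 1)), ‖P i s‖ ≤ m := by
    have : ∀ i, ∃ m : ℝ, 0 ≤ m ∧ (i < n → ∀ s ∈ Icc (t i) (t (i + 1)), ‖P i s‖ ≤ m) := fun i => by
      by_cases hi : i < n
      · obtain ⟨m, hm⟩ := isCompact_Icc.exists_bound_of_continuousOn (hPc i hi)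
        exact ⟨max m 0, le_max_right _ _, fun _ s hs => (hm s hs).trans (le_max_left _ _)⟩
      · exact ⟨0, le_rfl, fun h => absurd h hi⟩
    choose m hm0 hm using this
    exact ⟨∑ i ∈ Finset.range n, m i, fun i hi s hs => (hm i hi s hs).trans
      (Finset.single_le_sum (fun j _ => hm0 j) (Finset.mem_range.2 hi))⟩
  obtain ⟨m, hm0, hm⟩ : ∃ m : ℝ, 0 ≤ m ∧ ∀ i < n, ∀ s ∈ Icc (t i) (t (i + 1)), ‖P i s‖ ≤ m :=
    ⟨max m 0, le_max_right _ _, fun i hi s hs => (hm i hi s hs).trans (le_max_left _ _)⟩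
  rw [Asymptotics.isLittleO_iff]
  intro c hc
  -- The defect per unit time will be `ε * (C + 1) * ‖η - θ‖`; paired with `P` and integrated over
  -- `[0, T]`, it must stay below `c * ‖η - θ‖`.
  obtain ⟨ε, hε0, hε⟩ : ∃ ε : ℝ, 0 < ε ∧ m * (C + 1) * T * ε ≤ c := by
    have h0 : 0 ≤ m * (C + 1) * T := by positivity
    refine ⟨c / (m * (C + 1) * T + 1), by positivity, ?_⟩
    rw [mul_div_assoc', div_le_iff₀ (by positivity)]
    nlinarith
  have hyc := hy.continuousOn
  obtain ⟨r, hr, hexp⟩ := exists_forall_norm_sub_sub_fderiv_le hG'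
    (S := (fun s => (y s, θ)) '' Icc 0 T)
    (isCompact_Icc.image_of_continuousOn (hyc.prodMk continuousOn_const)) hε0
  have hnear : ∀ᶠ η in 𝓝 θ, (C + 1) * ‖η - θ‖ < r := by
    have : ContinuousAt (fun η : EuclideanSpace ℝ (Fin N) => (C + 1) * ‖η - θ‖) θ := by fun_prop
    exact this.eventually_lt continuousAt_const (by simpa using hr)
  filter_upwards [hz, hnear] with η ⟨hzη, hzy⟩ hηr
  -- `C + 1` dominates both `C`, for the state, and `1`, for the parameter.
  have hpair : ∀ s ∈ Icc 0 T, ‖(z η s, η) - (y s, θ)‖ ≤ (C + 1) * ‖η - θ‖ := fun s hs => by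
    rw [Prod.mk_sub_mk, norm_prod_le_iff]
    constructor <;> simp only <;> nlinarith [hzy s hs, norm_nonneg (η - θ)]
  have hrem : ∀ s ∈ Icc 0 T, ‖(-gradY G (z η s) η - -gradY G (y s) θ) -
      (-hessY G (y s) θ) (z η s - y s) - (-mixedDeriv G (y s) θ (η - θ))‖ ≤
        ε * ((C + 1) * ‖η - θ‖) := fun s hs => by
    have h := hexp _ (mem_image_of_mem _ hs) (z η s, η) ((hpair s hs).trans_lt hηr)
    refine le_trans (le_of_eq ?_) (h.trans (mul_le_mul_of_nonneg_left (hpair s hs) hε0.le))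
    rw [hessY_eq_fderiv_comp_inl hG', mixedDeriv_eq_fderiv_comp_inr hG', ← norm_neg]
    congr 1
    have : ((z η s, η) - (y s, θ) : EuclideanSpace ℝ (Fin d) × EuclideanSpace ℝ (Fin N)) =
        (z η s - y s, 0) + (0, η - θ) := by simp
    rw [this, map_add]
    simp only [neg_apply, ContinuousLinearMap.comp_apply,
      ContinuousLinearMap.inl_apply, ContinuousLinearMap.inr_apply]
    abel
  have hfield : ∀ {w : ℝ → EuclideanSpace ℝ (Fin d)} {ζ : EuclideanSpace ℝ (Fin N)},
      ContinuousOn w (Icc 0 T) → ContinuousOn (fun s => -gradY G (w s) ζ) (Icc 0 T) := fun hw =>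
    (hG'.continuous.comp_continuousOn (hw.prodMk continuousOn_const)).neg
  have hint : ∀ i ∈ Finset.range n,
      |⟪P i (t (i + 1)), z η (t (i + 1)) - y (t (i + 1))⟫_ℝ - ⟪P i (t i), z η (t i) - y (t i)⟫_ℝ
        - ∫ s in (t i)..(t (i + 1)), ⟪P i s, -mixedDeriv G (y s) θ (η - θ)⟫_ℝ| ≤
      m * (ε * ((C + 1) * ‖η - θ‖)) * (t (i + 1) - t i) := fun i hi => by
    have hi := Finset.mem_range.1 hi
    exact abs_inner_sub_inner_sub_integral_le (ht i hi).le
      (A := fun s => -hessY G (y s) θ) (δ := fun s => z η s - y s)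
      (δ' := fun s => -gradY G (z η s) η - -gradY G (y s) θ)
      (g := fun s => -mixedDeriv G (y s) θ (η - θ))
      ((continuousOn_hessY hG' hyc).neg.mono (hsub i hi)) (hPc i hi)
      (fun s hs => by simpa using hPd i hi s hs)
      (fun s hs => ((hzη.ode s (hsub i hi hs)).sub (hy.ode s (hsub i hi hs))).mono (hsub i hi))
      (((hfield hzη.continuousOn).sub (hfield hyc)).mono (hsub i hi))
      (((continuousOn_mixedDeriv hG' hyc).clm_apply continuousOn_const).neg.mono (hsub i hi))
      (hm i hi) (fun s hs => hrem s (hsub i hi hs))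
  -- Telescoping `⟪P i (t i), δ (t i)⟫`: both ends vanish, by the common initial value and by `P n =
  -- 0`, so only the jumps `v i` remain.
  have htel : ∑ i ∈ Finset.range n, (⟪P i (t (i + 1)), z η (t (i + 1)) - y (t (i + 1))⟫_ℝ -
      ⟪P i (t i), z η (t i) - y (t i)⟫_ℝ -
        ∫ s in (t i)..(t (i + 1)), ⟪P i s, -mixedDeriv G (y s) θ (η - θ)⟫_ℝ) =
      ∑ i ∈ Finset.range n, ⟪v i, z η (t (i + 1)) - y (t (i + 1))⟫_ℝ +
        ∑ i ∈ Finset.range n, ∫ s in (t i)..(t (i + 1)),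
          ⟪P i s, mixedDeriv G (y s) θ (η - θ)⟫_ℝ := by
    have h := Finset.sum_range_sub (fun i => ⟪P i (t i), z η (t i) - y (t i)⟫_ℝ) n
    have h0 : z η (t 0) - y (t 0) = 0 := by rw [ht0, hzη.init, hy.init, sub_self]
    rw [hPn, h0, Pi.zero_apply, inner_zero_left, inner_zero_right, sub_zero] at h
    rw [← add_zero (∑ i ∈ Finset.range n, ⟪v i, _⟫_ℝ), ← h, ← Finset.sum_add_distrib,
      ← Finset.sum_add_distrib]
    refine Finset.sum_congr rfl fun i hi => ?_
    rw [hPj i (Finset.mem_range.1 hi), inner_add_left]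
    simp only [inner_neg_right, intervalIntegral.integral_neg]
    ring
  rw [← htel, Real.norm_eq_abs]
  refine (Finset.abs_sum_le_sum_abs _ _).trans ((Finset.sum_le_sum hint).trans ?_)
  rw [← Finset.mul_sum, Finset.sum_range_sub, ht0, htn, sub_zero]
  calc m * (ε * ((C + 1) * ‖η - θ‖)) * T = (m * (C + 1) * T * ε) * ‖η - θ‖ := by ring
    _ ≤ c * ‖η - θ‖ := mul_le_mul_of_nonneg_right hε (norm_nonneg _)

/-- On the open interval `p` agrees with a version continuous up to both end points. -/
theorem IsCostate.intervalIntegrable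
    (hG' : ContDiff ℝ 1 (fun q : EuclideanSpace ℝ (Fin d) × EuclideanSpace ℝ (Fin N) =>
      gradY G q.1 q.2)) {T : ℝ} {n : ℕ} {t : ℕ → ℝ}
    (ht0 : t 0 = 0) (htn : t n = T) (ht : ∀ i < n, t i < t (i + 1))
    {L : ℕ → EuclideanSpace ℝ (Fin d) → ℝ}
    {θ : EuclideanSpace ℝ (Fin N)} {y p : ℝ → EuclideanSpace ℝ (Fin d)}
    (hy : ContinuousOn y (Icc 0 T)) (hp : IsCostate G T n t L θ y p) {i : ℕ} (hi : i < n) :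
    IntervalIntegrable (fun s => ContinuousLinearMap.adjoint (mixedDeriv G (y s) θ) (p s))
      MeasureTheory.volume (t i) (t (i + 1)) := by
  obtain ⟨P, hPc, hPe, -⟩ := hp.exists_continuous_extension htn ht
  have hB : ContinuousOn (fun s => ContinuousLinearMap.adjoint (mixedDeriv G (y s) θ))
      (Icc (t i) (t (i + 1))) :=
    ContinuousLinearMap.adjoint.continuous.comp_continuousOn ((continuousOn_mixedDeriv hG' hy).mono
      (by simpa only [ht0, htn] using Icc_node_subset ht hi))
  refine ((hB.clm_apply (hPc i hi)).intervalIntegrable_of_Icc (ht i hi).le).congr_uIoo ?_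
  intro s hs
  rw [uIoo_of_le (ht i hi).le] at hs
  simp only [hPe i hi (Ioo_subset_Ico_self hs)]

/-- The remainder splits into the Taylor remainders of the losses (`hloc`) and the error in
representing the linearized losses by the co-state (`hlin`). -/
theorem IsCostate.hasGradientAt_objective
    (hG' : ContDiff ℝ 1 (fun q : EuclideanSpace ℝ (Fin d) × EuclideanSpace ℝ (Fin N) =>
      gradY G q.1 q.2)) {x₀ : EuclideanSpace ℝ (Fin d)} {T : ℝ} {n : ℕ} {t : ℕ → ℝ}
    (ht0 : t 0 = 0) (htn : t n = T) (ht : ∀ i < n, t i < t (i + 1))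
    {L : ℕ → EuclideanSpace ℝ (Fin d) → ℝ}
    {θ : EuclideanSpace ℝ (Fin N)} {y p : ℝ → EuclideanSpace ℝ (Fin d)}
    (hy : IsStateTrajectory G x₀ T θ y)
    (hL : ∀ i, 1 ≤ i → i ≤ n → DifferentiableAt ℝ (L i) (y (t i)))
    (hp : IsCostate G T n t L θ y p) :
    HasGradientAt (objective G x₀ T n t L)
      (-∑ i ∈ Finset.range n, ∫ s in (t i)..(t (i + 1)),
        ContinuousLinearMap.adjoint (mixedDeriv G (y s) θ) (p s)) θ := by
  have hT : 0 ≤ T := by rw [← ht0, ← htn]; exact node_le ht (Nat.zero_le n) le_rfl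
  obtain ⟨C, hC, hnear⟩ := hy.exists_near hG' hT
  set z := stateOf G x₀ T
  have hz : ∀ᶠ η in 𝓝 θ, IsStateTrajectory G x₀ T η (z η) ∧
      ∀ s ∈ Icc 0 T, ‖z η s - y s‖ ≤ C * ‖η - θ‖ := by
    filter_upwards [hnear] with η ⟨w, hw, hwy⟩
    refine ⟨hw.stateOf, fun s hs => ?_⟩
    -- Uniqueness transfers the Lipschitz bound to the solution chosen by `stateOf`.
    rw [show z η s = w s from hw.eqOn hG' hw.stateOf hs]
    exact hwy s hs
  have hmem : ∀ i ∈ Finset.range n, t (i + 1) ∈ Icc 0 T := fun i hi => by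
    have h := Icc_node_subset ht (Finset.mem_range.1 hi)
      (right_mem_Icc.2 (ht i (Finset.mem_range.1 hi)).le)
    rwa [ht0, htn] at h
  obtain ⟨P, hPc, hPe, hPd, hPn, hPj⟩ := hp.exists_continuous_extension htn ht
  have hlin := isLittleO_linearized_objective_add_integral hG' ht0 htn ht hy hC hz hPc hPd hPn hPj
  have hloc : (fun η => ∑ i ∈ Finset.range n, (L (i + 1) (z η (t (i + 1))) -
      L (i + 1) (y (t (i + 1))) - ⟪gradient (L (i + 1)) (y (t (i + 1))),
        z η (t (i + 1)) - y (t (i + 1))⟫_ℝ)) =o[𝓝 θ] (fun η => η - θ) := by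
    refine Asymptotics.IsLittleO.fun_sum fun i hi => ?_
    have hO : (fun η => z η (t (i + 1)) - y (t (i + 1))) =O[𝓝 θ] (fun η => η - θ) :=
      Asymptotics.IsBigO.of_bound C (hz.mono fun η h => h.2 _ (hmem i hi))
    have htend : Filter.Tendsto (fun η => z η (t (i + 1))) (𝓝 θ) (𝓝 (y (t (i + 1)))) := by
      refine tendsto_sub_nhds_zero_iff.1 (hO.trans_tendsto ?_)
      exact tendsto_sub_nhds_zero_iff.2 Filter.tendsto_id
    have hgrad := (hL (i + 1) (by omega) (Finset.mem_range.1 hi)).hasGradientAt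
    exact ((hasGradientAt_iff_isLittleO.1 hgrad).comp_tendsto htend).trans_isBigO hO
  -- The pairing with `h` passes inside the integral and through the adjoint; `p` and `P i` differ
  -- at most at an end point.
  have hgradient : ∀ h, ⟪-∑ i ∈ Finset.range n, ∫ s in (t i)..(t (i + 1)),
      ContinuousLinearMap.adjoint (mixedDeriv G (y s) θ) (p s), h⟫_ℝ =
      -∑ i ∈ Finset.range n, ∫ s in (t i)..(t (i + 1)), ⟪P i s, mixedDeriv G (y s) θ h⟫_ℝ := by
    intro h
    rw [inner_neg_left, sum_inner]
    congr 1
    refine Finset.sum_congr rfl fun i hi => ?_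
    have hi := Finset.mem_range.1 hi
    rw [real_inner_comm]
    have hI := hp.intervalIntegrable hG' ht0 htn ht hy.continuousOn hi
    have := ((innerSL ℝ h).intervalIntegral_comp_comm hI).symm
    simp only [innerSL_apply_apply] at this
    rw [this]
    refine intervalIntegral.integral_congr_Ioo_of_le (ht i hi).le fun s hs => ?_
    rw [real_inner_comm, ContinuousLinearMap.adjoint_inner_left,
      hPe i hi (Ioo_subset_Ico_self hs)]
  have hobj : ∀ η, objective G x₀ T n t L η =
      ∑ i ∈ Finset.range n, L (i + 1) (z η (t (i + 1))) := fun η => by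
    rw [objective, Finset.range_eq_Ico, Finset.sum_Ico_add' (fun i => L i (z η (t i))) 0 n 1]
    rfl
  rw [hasGradientAt_iff_isLittleO]
  refine (hloc.add hlin).congr_left fun η => ?_
  rw [hgradient, hobj, hobj]
  have hθ : ∑ i ∈ Finset.range n, L (i + 1) (z θ (t (i + 1))) =
      ∑ i ∈ Finset.range n, L (i + 1) (y (t (i + 1))) :=
    Finset.sum_congr rfl fun i hi =>
      congrArg (L (i + 1)) (hy.eqOn hG' hy.stateOf (hmem i hi))
  rw [hθ, Finset.sum_sub_distrib, Finset.sum_sub_distrib]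
  ring

end OptimalControlNet

theorem mainTheorem3 {d N : ℕ}
    (G : EuclideanSpace ℝ (Fin d) → EuclideanSpace ℝ (Fin N) → ℝ)
    (hG : ∀ θ, Differentiable ℝ (fun y => G y θ))
    (hG' : ContDiff ℝ 1 (fun q : EuclideanSpace ℝ (Fin d) × EuclideanSpace ℝ (Fin N) =>
      OptimalControlNet.gradY G q.1 q.2))
    (x₀ : EuclideanSpace ℝ (Fin d)) (T : ℝ)
    (n : ℕ) (hn : 1 ≤ n) (t : ℕ → ℝ) (ht0 : t 0 = 0) (htn : t n = T)
    (ht : ∀ i < n, t i < t (i + 1))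
    (L : ℕ → EuclideanSpace ℝ (Fin d) → ℝ)
    (θ : EuclideanSpace ℝ (Fin N)) (y : ℝ → EuclideanSpace ℝ (Fin d))
    (hy : OptimalControlNet.IsStateTrajectory G x₀ T θ y)
    (hL : ∀ i, 1 ≤ i → i ≤ n → DifferentiableAt ℝ (L i) (y (t i))) :
    -- near `θ` the forward problem is uniquely solvable on `[0, T]`, so that `J` is meaningful
    (∀ᶠ η in 𝓝 θ, ∃ z, OptimalControlNet.IsStateTrajectory G x₀ T η z ∧
      ∀ w, OptimalControlNet.IsStateTrajectory G x₀ T η w → Set.EqOn w z (Set.Icc 0 T)) ∧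
    -- a co-state trajectory exists
    (∃ p, OptimalControlNet.IsCostate G T n t L θ y p) ∧
    -- and every co-state trajectory gives the gradient of `J` at `θ`
    (∀ p, OptimalControlNet.IsCostate G T n t L θ y p →
      IntervalIntegrable (fun s => ContinuousLinearMap.adjoint
        (OptimalControlNet.mixedDeriv G (y s) θ) (p s)) MeasureTheory.volume 0 T ∧
      HasGradientAt (OptimalControlNet.objective G x₀ T n t L)
        (-∑ i ∈ Finset.range n, ∫ s in (t i)..(t (i + 1)),
          ContinuousLinearMap.adjoint (OptimalControlNet.mixedDeriv G (y s) θ) (p s)) θ ∧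
      HasGradientAt (OptimalControlNet.objective G x₀ T n t L)
        (-∫ s in (0 : ℝ)..T,
          ContinuousLinearMap.adjoint (OptimalControlNet.mixedDeriv G (y s) θ) (p s)) θ) := by

  have hT : 0 ≤ T := by
    rw [← ht0, ← htn]; exact OptimalControlNet.node_le ht (Nat.zero_le n) le_rfl
  refine ⟨?_, OptimalControlNet.exists_isCostate hG' hn ht0 htn ht L hy.continuousOn,
    fun p hp => ?_⟩
  · obtain ⟨C, -, h⟩ := hy.exists_near hG' hT
    exact h.mono fun η ⟨z, hz, _⟩ => ⟨z, hz, fun w hw => hz.eqOn hG' hw⟩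
  · have hint : ∀ i < n, IntervalIntegrable (fun s => ContinuousLinearMap.adjoint
        (OptimalControlNet.mixedDeriv G (y s) θ) (p s)) MeasureTheory.volume (t i) (t (i + 1)) :=
      fun i hi => hp.intervalIntegrable hG' ht0 htn ht hy.continuousOn hi
    have hgrad := hp.hasGradientAt_objective hG' ht0 htn ht hy hL
    have hint' := IntervalIntegrable.trans_iterate hint
    have hgrad' := hgrad
    rw [intervalIntegral.sum_integral_adjacent_intervals hint, ht0, htn] at hgrad'
    rw [ht0, htn] at hint'
    exact ⟨hint', hgrad, hgrad'⟩
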